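/- For a finite group $G$ of order $v$ (written additively) and a family $A=(A_1,\dots,A_s)$ of pairwise disjoint $k$-subsets of $G\setminus\{0\}$, put $S=\bigcup_i A_i$, let $\mathrm{Int}(A)$ be the multiset of all differences $x-y$ with $x\ne y$ in the same $A_i$ ($1\le i\le s$), and let $\mathrm{Ext}(A)$ be the multiset of all differences $x-y$ with $x\in A_i$, $y\in A_j$, $i\neq j$. The family $A$ is a $(v,s,k,\lambda,\mu)$-DPDF (respectively, EPDF) in $G$ if $\mathrm{Int}(A)$ (respectively, $\mathrm{Ext}(A)$) contains each non-identity element of $S$ exactly $\lambda$ times and each non-identity element of $G\setminus S$ exactly $\mu$ times. Corollary 4.15. Let $r$ be a positive integer, $n=2^r+1$ and $m=(n-1)^2+1$. Then there exists a family of subsets of the cyclic group $\mathbb{Z}_{mn}$ that is both an $(mn,\,n,\,(n-1)^2,\,n(n-2),\,0)$-DPDF and an $(mn,\,n,\,(n-1)^2,\,n(n-1)(n-2),\,n(n-1)^2)$-EPDF in $\mathbb{Z}_{mn}$. -/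

import Mathlib

namespace PartialDiffFamily

variable {G : Type*} [AddGroup G] [DecidableEq G]

/-- The multiset `Δ(D) = {x - y : x ≠ y ∈ D}` of internal differences of a finite set `D`. -/
def internalDiff (D : Finset G) : Multiset G :=
  D.offDiag.val.map fun p => p.1 - p.2

/-- The multiset `Δ(D₁, D₂) = {x - y : x ∈ D₁, y ∈ D₂}` of differences between two finite sets. -/
def crossDiff (D₁ D₂ : Finset G) : Multiset G :=
  (D₁ ×ˢ D₂).val.map fun p => p.1 - p.2

/-- `Int(A)`: the multiset union (multiplicities add up) of the `Δ(A_i)`. -/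
def intDiff {s : ℕ} (A : Fin s → Finset G) : Multiset G :=
  ∑ i, internalDiff (A i)

/-- `Ext(A)`: the multiset union (multiplicities add up) of the `Δ(A_i, A_j)` over all ordered
pairs of distinct indices. -/
def extDiff {s : ℕ} (A : Fin s → Finset G) : Multiset G :=
  ∑ p ∈ (Finset.univ : Finset (Fin s)).offDiag, crossDiff (A p.1) (A p.2)

/-- `A = (A_1, …, A_s)` is a family of `s` pairwise disjoint `k`-subsets of `G* = G \ {0}`, where
`G` is a finite group of order `v`. -/
structure IsDisjointFamily (v s k : ℕ) (A : Fin s → Finset G) : Prop where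
  finite : Finite G
  order_eq : Nat.card G = v
  card_eq : ∀ i, (A i).card = k
  zero_notMem : ∀ i, (0 : G) ∉ A i
  disjoint : ∀ i j, i ≠ j → Disjoint (A i) (A j)

/-- `A` is a `(v, s, k, lam, mu)`-disjoint partial difference family in `G`: `Int(A)` contains each
non-identity element of `S = ⋃ A_i` exactly `lam` times and each non-identity element of `G \ S`
exactly `mu` times. -/
structure IsDPDF (v s k lam mu : ℕ) (A : Fin s → Finset G) : Prop
    extends IsDisjointFamily v s k A where
  count_mem : ∀ g : G, g ≠ 0 → g ∈ Finset.univ.biUnion A → (intDiff A).count g = lam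
  count_notMem : ∀ g : G, g ≠ 0 → g ∉ Finset.univ.biUnion A → (intDiff A).count g = mu

/-- `A` is a `(v, s, k, lam, mu)`-external partial difference family in `G`: `Ext(A)` contains each
non-identity element of `S = ⋃ A_i` exactly `lam` times and each non-identity element of `G \ S`
exactly `mu` times. -/
structure IsEPDF (v s k lam mu : ℕ) (A : Fin s → Finset G) : Prop
    extends IsDisjointFamily v s k A where
  count_mem : ∀ g : G, g ≠ 0 → g ∈ Finset.univ.biUnion A → (extDiff A).count g = lam
  count_notMem : ∀ g : G, g ≠ 0 → g ∉ Finset.univ.biUnion A → (extDiff A).count g = mu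

end PartialDiffFamily

namespace PartialDiffFamily

open Finset

/-! ### Counting differences in partitions of a subgroup's complement -/

section Combinatorics

variable {G : Type*} [AddCommGroup G] [DecidableEq G]

/-! Let `q = 2 ^ r`, let `F` have `q ^ 4` elements, and identify `ZMod N` with `Fˣ / 𝔽_q^*`. The
trace to `𝔽_{q^2}` is `𝔽_q`-linear, so `z ↦ Tr(z) ^ (q - 1)` descends to this quotient. In
characteristic 2 its zero set is a subgroup, `H = 𝔽_{q^2}^* / 𝔽_q^*` of order `q + 1`. The other
values are the `(q + 1)`-th roots of unity, and their fibres are the `A i`. For `w` outside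
`𝔽_{q^2}`, `w * z` and `z` lie in one class iff `Tr(z) ≠ 0` and `Tr(w * z) = l * Tr(z)` with `l ∈
𝔽_q^*`, that is, `(w + l) * z ∈ 𝔽_{q^2}^*`. Counting pairs gives the internal differences
(`card_relTrace_mul_pow_eq`). The external ones follow by subtraction, since the classes partition
the complement of `H` (`isDPDF_and_isEPDF_of_partition_compl`). -/

lemma count_crossDiff (D₁ D₂ : Finset G) (g : G) :
    (crossDiff D₁ D₂).count g = #{y ∈ D₂ | y + g ∈ D₁} := by
  rw [crossDiff, Multiset.count_map, ← Finset.filter_val, Finset.card_val]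
  refine Finset.card_bij' (fun p _ => p.2) (fun y _ => (y + g, y)) ?_ ?_ ?_ ?_
  · rintro ⟨a, b⟩ h
    simp only [mem_filter, mem_product] at h ⊢
    obtain ⟨⟨h1, h2⟩, rfl⟩ := h
    simpa [h2] using h1
  · intro y h
    simp only [mem_filter, mem_product] at h ⊢
    simpa using h.symm
  · rintro ⟨a, b⟩ h
    simp only [mem_filter] at h
    simp [h.2]
  · simp

lemma count_internalDiff (D : Finset G) {g : G} (hg : g ≠ 0) :
    (internalDiff D).count g = (crossDiff D D).count g := by
  rw [internalDiff, crossDiff, Multiset.count_map, Multiset.count_map, ← Finset.filter_val,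
    ← Finset.filter_val, Finset.card_val, Finset.card_val]
  congr 1
  ext ⟨a, b⟩
  simp only [mem_filter, mem_offDiag, mem_product]
  constructor
  · rintro ⟨⟨h1, h2, -⟩, h⟩
    exact ⟨⟨h1, h2⟩, h⟩
  · rintro ⟨⟨h1, h2⟩, h⟩
    refine ⟨⟨h1, h2, ?_⟩, h⟩
    rintro rfl
    exact hg (by simpa using h)

variable {s : ℕ} {A : Fin s → Finset G}

lemma count_intDiff (hA : ∀ i j, i ≠ j → Disjoint (A i) (A j)) {g : G} (hg : g ≠ 0) :
    (intDiff A).count g = #(univ.biUnion fun i => {y ∈ A i | y + g ∈ A i}) := by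
  rw [intDiff, Multiset.count_sum', card_biUnion]
  · exact sum_congr rfl fun i _ => by rw [count_internalDiff _ hg, count_crossDiff]
  · exact fun i _ j _ hij => (hA i j hij).mono (filter_subset _ _) (filter_subset _ _)

/-- Diagonal and off-diagonal index pairs together exhaust all pairs, so only the union of the
family matters; this turns internal counts into external ones. -/
lemma count_intDiff_add_count_extDiff (hA : ∀ i j, i ≠ j → Disjoint (A i) (A j))
    {g : G} (hg : g ≠ 0) :
    (intDiff A).count g + (extDiff A).count g =
      #{y ∈ univ.biUnion A | y + g ∈ univ.biUnion A} := by
  have h1 : (intDiff A).count g =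
      ∑ p ∈ (univ : Finset (Fin s)).diag, (crossDiff (A p.1) (A p.2)).count g := by
    rw [intDiff, Multiset.count_sum', sum_diag]
    exact sum_congr rfl fun i _ => count_internalDiff _ hg
  rw [h1, extDiff, Multiset.count_sum', ← sum_union (disjoint_diag_offDiag _), diag_union_offDiag]
  have h2 : ({y ∈ univ.biUnion A | y + g ∈ univ.biUnion A} : Finset G) =
      (univ ×ˢ univ : Finset (Fin s × Fin s)).biUnion
        fun p => {y ∈ A p.2 | y + g ∈ A p.1} := by
    ext y
    simp only [mem_filter, mem_biUnion, mem_univ, true_and, mem_product, Prod.exists]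
    constructor
    · rintro ⟨⟨i, hi⟩, j, hj⟩
      exact ⟨j, i, hi, hj⟩
    · rintro ⟨j, i, hi, hj⟩
      exact ⟨⟨i, hi⟩, j, hj⟩
  rw [h2, card_biUnion]
  · exact sum_congr rfl fun p _ => count_crossDiff _ _ _
  · rintro ⟨i, j⟩ - ⟨i', j'⟩ - hne
    rw [Function.onFun, disjoint_left]
    intro y hy hy'
    simp only [mem_filter] at hy hy'
    by_cases hj : j = j'
    · subst hj
      have hi : i ≠ i' := fun h => hne (by rw [h])
      exact disjoint_left.1 (hA _ _ hi) hy.2 hy'.2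
    · exact disjoint_left.1 (hA _ _ hj) hy.1 hy'.1

/-- A family partitioning the complement of a subgroup `H` of order `n`, each of whose members
meets every coset of `H` at most once, and whose internal differences cover `G \ H` exactly
`lam` times, is both a DPDF and an EPDF. -/
theorem isDPDF_and_isEPDF_of_partition_compl [Fintype G] {n k lam : ℕ} (H : AddSubgroup G)
    (A : Fin s → Finset G) (hk : ∀ i, #(A i) = k)
    (hA : ∀ i j, i ≠ j → Disjoint (A i) (A j))
    (hS : ∀ x, x ∈ univ.biUnion A ↔ x ∉ H) (hH : Nat.card H = n)
    (hcoset : ∀ i, ∀ x ∈ A i, ∀ g ∈ H, x + g ∈ A i → g = 0)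
    (hlam : ∀ g ∉ H, #(univ.biUnion fun i => {y ∈ A i | y + g ∈ A i}) = lam) :
    IsDPDF (Nat.card G) s k lam 0 A ∧
      IsEPDF (Nat.card G) s k (Nat.card G - 2 * n - lam) (Nat.card G - n) A := by
  classical
  have hfam : IsDisjointFamily (Nat.card G) s k A :=
    { finite := inferInstance
      order_eq := rfl
      card_eq := hk
      zero_notMem := fun i hi => (hS 0).1 (mem_biUnion.2 ⟨i, mem_univ _, hi⟩) H.zero_mem
      disjoint := hA }
  have hint : ∀ g, g ≠ 0 → g ∈ H → (intDiff A).count g = 0 := by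
    intro g hg hgH
    rw [count_intDiff hA hg, card_eq_zero, eq_empty_iff_forall_notMem]
    intro y hy
    obtain ⟨i, -, hi⟩ := mem_biUnion.1 hy
    rw [mem_filter] at hi
    exact hg (hcoset i y hi.1 g hgH hi.2)
  have hint' : ∀ g, g ≠ 0 → g ∉ H → (intDiff A).count g = lam := fun g hg hgH => by
    rw [count_intDiff hA hg, hlam g hgH]
  have hcH : #{y : G | y ∈ H} = n := by
    rw [← hH, Nat.card_eq_fintype_card, Fintype.card_subtype]
  have hcH' (g : G) : #{y : G | y + g ∈ H} = n := by
    rw [← hcH]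
    exact card_bij' (fun y _ => y + g) (fun y _ => y - g) (by simp) (by simp) (by simp) (by simp)
  -- The excluded `y` form `H ∪ (H - g)`: two disjoint cosets if `g ∉ H`, a single one if `g ∈ H`.
  have hsum (g : G) : #{y ∈ univ.biUnion A | y + g ∈ univ.biUnion A} =
      Nat.card G - #(({y : G | y ∈ H} : Finset G) ∪ ({y : G | y + g ∈ H} : Finset G)) := by
    rw [Nat.card_eq_fintype_card, ← card_compl]
    congr 1
    ext y
    rw [mem_filter, hS, hS]
    simp
  refine ⟨⟨hfam, ?_, ?_⟩, ⟨hfam, ?_, ?_⟩⟩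
  · exact fun g hg h => hint' g hg ((hS g).1 h)
  · exact fun g hg h => hint g hg (by_contra fun h' => h ((hS g).2 h'))
  · intro g hg h
    have hgH := (hS g).1 h
    have := count_intDiff_add_count_extDiff hA hg
    rw [hsum, hint' g hg hgH, card_union_of_disjoint, hcH, hcH'] at this
    · omega
    · rw [disjoint_left]
      intro y hy hy'
      simp only [mem_filter, mem_univ, true_and] at hy hy'
      exact hgH ((H.add_mem_cancel_left hy).1 hy')
  · intro g hg h
    have hgH : g ∈ H := by_contra fun h' => h ((hS g).2 h')
    have := count_intDiff_add_count_extDiff hA hg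
    rw [hsum, hint g hg hgH, zero_add] at this
    rw [this]
    have : ({y : G | y + g ∈ H} : Finset G) = ({y : G | y ∈ H} : Finset G) := by
      ext y
      simp [H.add_mem_cancel_right hgH]
    rw [this, union_self, hcH]

end Combinatorics

/-! ### Cyclic quotients of the unit group -/

/-- Counting along a surjective homomorphism: all fibres have the size of the kernel. -/
lemma card_filter_comp_of_surjective {U G : Type*} [Group U] [Fintype U] [AddGroup G] [Fintype G]
    [DecidableEq G] (π : U →* Multiplicative G) (hπ : Function.Surjective π)
    (P : G → Prop) [DecidablePred P] :
    #{z : U | P (π z).toAdd} = Nat.card π.ker * #{y : G | P y} := by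
  classical
  rw [card_eq_sum_card_fiberwise (f := fun z => (π z).toAdd) (t := {y : G | P y})
    (fun z hz => by simpa using hz), mul_comm]
  refine sum_const_nat fun y hy => ?_
  have h1 : Nat.card π.ker = #{z : U | π z = 1} := by
    rw [Nat.card_eq_fintype_card, ← Fintype.card_subtype]
    exact Fintype.card_congr (Equiv.refl _)
  have hy' : P y := by simpa using hy
  rw [h1, MonoidHom.card_fiber_eq_of_mem_range π (hπ 1) (hπ (Multiplicative.ofAdd y)), filter_filter]
  congr 1
  ext z
  simp only [mem_filter, mem_univ, true_and]
  constructor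
  · rintro ⟨-, h⟩
    exact h
  · intro h
    have h' : (π z).toAdd = y := h
    exact ⟨h'.symm ▸ hy', h'⟩

lemma card_units_pow_eq_one {F : Type*} [Field F] [Fintype F] [DecidableEq F] {d e : ℕ}
    (hF : Fintype.card F = d * e + 1) : #{u : Fˣ | u ^ d = 1} = d := by
  have h := IsCyclic.card_powMonoidHom_ker Fˣ d
  rw [Nat.card_units, Nat.card_eq_fintype_card (α := F), hF, Nat.add_sub_cancel,
    Nat.gcd_eq_right ⟨e, rfl⟩] at h
  rw [← Fintype.card_subtype, ← Nat.card_eq_fintype_card]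
  exact (Nat.card_congr (Equiv.refl _)).trans h

/-- The `d`-th power map has the required kernel, and its image is cyclic of order `N`. -/
lemma exists_surjective_unitsHom {F : Type*} [Field F] [Fintype F] {d N : ℕ}
    (hF : Fintype.card F = d * N + 1) (hd : 0 < d) :
    ∃ π : Fˣ →* Multiplicative (ZMod N), Function.Surjective π ∧
      ∀ u, π u = 1 ↔ u ^ d = 1 := by
  have h := IsCyclic.card_powMonoidHom_range Fˣ d
  rw [Nat.card_units, Nat.card_eq_fintype_card (α := F), hF, Nat.add_sub_cancel,
    Nat.gcd_eq_right ⟨N, rfl⟩, Nat.mul_div_cancel_left _ hd] at h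
  let e : (powMonoidHom d : Fˣ →* Fˣ).range ≃* Multiplicative (ZMod N) :=
    mulEquivOfCyclicCardEq (by rw [h]; exact (Nat.card_zmod N).symm)
  refine ⟨e.toMonoidHom.comp (powMonoidHom d : Fˣ →* Fˣ).rangeRestrict,
    e.surjective.comp (MonoidHom.rangeRestrict_surjective _), fun u => ?_⟩
  simp [Subtype.ext_iff]

/-! ### The relative trace in characteristic 2 -/

section RelTrace

variable {F : Type*} [Field F]

/-- The relative trace `z + z ^ (q ^ 2)` of `𝔽_{q^4}` over `𝔽_{q^2}`. -/
def relTrace (q : ℕ) (z : F) : F := z + z ^ q ^ 2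

lemma pow_eq_self_iff {d : ℕ} (hd : 0 < d) {z : F} (hz : z ≠ 0) : z ^ d = z ↔ z ^ (d - 1) = 1 := by
  obtain ⟨e, rfl⟩ := Nat.exists_eq_add_of_le' hd
  rw [pow_succ, Nat.add_sub_cancel]
  exact mul_eq_right₀ hz

lemma pow_sq_eq_self_of_pow_eq_one {q : ℕ} {z : F} (hq : 0 < q) (h : z ^ (q - 1) = 1) : z ^ q ^ 2 = z := by
  have : z ^ q = z := by
    obtain ⟨e, rfl⟩ := Nat.exists_eq_add_of_le' hq
    rw [pow_succ]
    rw [Nat.add_sub_cancel] at h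
    rw [h, one_mul]
  rw [pow_two, pow_mul, this, this]

lemma relTrace_mul {q : ℕ} {l : F} (hl : l ^ q ^ 2 = l) (z : F) :
    relTrace q (l * z) = l * relTrace q z := by
  rw [relTrace, relTrace, mul_pow, hl, mul_add]

variable [CharP F 2] {q : ℕ}

/-- Signs vanish in characteristic 2, so the kernel of the trace is the fixed field `𝔽_{q^2}`
itself; this is what makes `H` a subgroup. -/
lemma relTrace_eq_zero_iff (z : F) : relTrace q z = 0 ↔ z ^ q ^ 2 = z := by
  rw [relTrace, CharTwo.add_eq_zero, eq_comm]

lemma relTrace_add {r : ℕ} (hq : q = 2 ^ r) (y z : F) :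
    relTrace q (y + z) = relTrace q y + relTrace q z := by
  simp only [relTrace, hq, ← pow_mul, add_pow_char_pow]
  ring

lemma relTrace_pow {r : ℕ} (hq : q = 2 ^ r) [Fintype F] (hF : Fintype.card F = q ^ 4) (z : F) :
    relTrace q z ^ q ^ 2 = relTrace q z := by
  have h : (z ^ q ^ 2) ^ q ^ 2 = z := by
    rw [← pow_mul, ← pow_add, ← hF, FiniteField.pow_card]
  nth_rewrite 1 [relTrace]
  have h2 : q ^ 2 = 2 ^ (r * 2) := by rw [hq, pow_mul]
  nth_rewrite 2 [h2]
  rw [add_pow_char_pow, ← h2, h, add_comm, relTrace]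

variable [Fintype F] [DecidableEq F]

lemma card_relTrace_eq_zero (hq : 2 ≤ q) (hF : Fintype.card F = q ^ 4) :
    #{z : Fˣ | relTrace q (z : F) = 0} = q ^ 2 - 1 := by
  have h4 : 4 ≤ q ^ 2 := by nlinarith
  have hF' : Fintype.card F = (q ^ 2 - 1) * (q ^ 2 + 1) + 1 := by
    rw [hF]
    zify [show 1 ≤ q ^ 2 by omega]
    ring
  rw [← card_units_pow_eq_one hF']
  congr 1
  ext z
  simp only [mem_filter, mem_univ, true_and]
  rw [relTrace_eq_zero_iff, pow_eq_self_iff (by omega) z.ne_zero, Units.ext_iff, Units.val_pow_eq_pow_val,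
    Units.val_one]

/-- The solutions `z` are exactly the quotients `k / (w - l)` with `l ∈ 𝔽_q^*`, `k ∈ 𝔽_{q^2}^*`. -/
lemma card_relTrace_mul_pow_eq {r : ℕ} (hr : 1 ≤ r) (hq : q = 2 ^ r) (hF : Fintype.card F = q ^ 4)
    (w : Fˣ) (hw : relTrace q (w : F) ≠ 0) :
    #{z : Fˣ | relTrace q (z : F) ≠ 0 ∧
      relTrace q ((w * z : Fˣ) : F) ^ (q - 1) = relTrace q (z : F) ^ (q - 1)} =
      (q - 1) * (q ^ 2 - 1) := by
  have hq2 : 2 ≤ q := hq ▸ (by simpa using Nat.pow_le_pow_right (n := 2) (by norm_num) hr)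
  have hL : #{l : Fˣ | l ^ (q - 1) = 1} = q - 1 := by
    refine card_units_pow_eq_one (e := (q ^ 2 + 1) * (q + 1)) ?_
    rw [hF]
    zify [show 1 ≤ q by omega]
    ring
  rw [show (q - 1) * (q ^ 2 - 1) =
    #{l : Fˣ | l ^ (q - 1) = 1} * #{z : Fˣ | relTrace q (z : F) = 0} by
      rw [hL, card_relTrace_eq_zero hq2 hF], ← card_product]
  symm
  have hfix {l : Fˣ} (hl : l ^ (q - 1) = 1) : (l : F) ^ q ^ 2 = l :=
    pow_sq_eq_self_of_pow_eq_one (by omega) (by simpa [Units.ext_iff] using hl)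
  have hmul {l : Fˣ} (hl : l ^ (q - 1) = 1) (z : F) :
      relTrace q ((w + l) * z) = relTrace q (w * z) + l * relTrace q z := by
    rw [add_mul, relTrace_add hq, relTrace_mul (hfix hl)]
  -- Otherwise `w = l` would lie in `𝔽_q`, where the trace vanishes.
  have hne {l : Fˣ} (hl : l ^ (q - 1) = 1) : (w : F) + l ≠ 0 := by
    intro h
    rw [CharTwo.add_eq_zero] at h
    exact hw ((relTrace_eq_zero_iff _).2 (by rw [h, hfix hl]))
  have htr {l : Fˣ} (hl : l ^ (q - 1) = 1) : relTrace q ((w : F) + l) ≠ 0 := by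
    rwa [relTrace_add hq, (relTrace_eq_zero_iff (l : F)).2 (hfix hl), add_zero]
  refine card_bij (fun p hp => p.2 * (Units.mk0 ((w : F) + p.1)
    (hne (by simpa using (mem_product.1 hp).1)))⁻¹) ?_ ?_ ?_
  · rintro ⟨l, k⟩ h
    simp only [mem_product, mem_filter, mem_univ, true_and] at h ⊢
    obtain ⟨hl, hk⟩ := h
    set z : Fˣ := k * (Units.mk0 ((w : F) + l) (hne hl))⁻¹ with hz
    have hzk : ((w : F) + l) * z = k := by
      rw [hz]
      simp only [Units.val_mul, Units.val_inv_eq_inv_val, Units.val_mk0]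
      field_simp [hne hl]
    have hz0 : relTrace q (z : F) ≠ 0 := by
      intro h
      rw [← hzk, mul_comm, relTrace_mul ((relTrace_eq_zero_iff _).1 h)] at hk
      exact mul_ne_zero z.ne_zero (htr hl) hk
    refine ⟨hz0, ?_⟩
    rw [← hzk, hmul hl, CharTwo.add_eq_zero] at hk
    rw [Units.val_mul, hk, mul_pow]
    rw [Units.ext_iff, Units.val_pow_eq_pow_val, Units.val_one] at hl
    rw [hl, one_mul]
  · rintro ⟨l, k⟩ h ⟨l', k'⟩ h' heq
    simp only [mem_product, mem_filter, mem_univ, true_and] at h h' heq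
    obtain ⟨hl, hk⟩ := h
    obtain ⟨hl', hk'⟩ := h'
    set z : Fˣ := k * (Units.mk0 ((w : F) + l) (hne hl))⁻¹ with hz
    have hzk : ((w : F) + l) * z = k := by
      rw [hz]
      simp only [Units.val_mul, Units.val_inv_eq_inv_val, Units.val_mk0]
      field_simp [hne hl]
    have hzk' : ((w : F) + l') * z = k' := by
      rw [heq]
      simp only [Units.val_mul, Units.val_inv_eq_inv_val, Units.val_mk0]
      field_simp [hne hl']
    have hz0 : relTrace q (z : F) ≠ 0 := by
      intro h
      rw [← hzk, mul_comm, relTrace_mul ((relTrace_eq_zero_iff _).1 h)] at hk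
      exact mul_ne_zero z.ne_zero (htr hl) hk
    -- `l` is recovered from `z` as `Tr(w * z) / Tr(z)`.
    have hll : l = l' := by
      rw [← hzk, hmul hl, CharTwo.add_eq_zero] at hk
      rw [← hzk', hmul hl', CharTwo.add_eq_zero, hk] at hk'
      exact Units.ext (mul_right_cancel₀ hz0 hk')
    subst hll
    rw [hzk] at hzk'
    rw [Units.ext hzk']
  · intro z h
    simp only [mem_filter, mem_univ, true_and] at h
    obtain ⟨hz0, h⟩ := h
    have hwz : relTrace q (w * z : F) ≠ 0 := by
      intro h0
      rw [Units.val_mul, h0, zero_pow (by omega), eq_comm] at h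
      exact hz0 (eq_zero_of_pow_eq_zero h)
    let l : Fˣ := Units.mk0 (relTrace q (w * z : F) / relTrace q (z : F)) (div_ne_zero hwz hz0)
    have hl : l ^ (q - 1) = 1 := by
      rw [Units.ext_iff, Units.val_pow_eq_pow_val, Units.val_mk0, div_pow, Units.val_one,
        ← Units.val_mul, h, div_self (pow_ne_zero _ hz0)]
    refine ⟨(l, Units.mk0 ((w : F) + l) (hne hl) * z), ?_, ?_⟩
    · simp only [mem_product, mem_filter, mem_univ, true_and, Units.val_mul, Units.val_mk0]
      refine ⟨hl, ?_⟩
      rw [hmul hl, CharTwo.add_eq_zero, Units.val_mk0, div_mul_cancel₀ _ hz0]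
    · simp

end RelTrace

/-! ### Construction of the family -/

/-- The classes `{z | Tr(z) ^ (q - 1) = η ^ i}` of `𝔽_{q^4}^* / 𝔽_q^*`, for `q` a power of two and
`η` of order `q + 1`, form the required family. -/
theorem exists_isDPDF_and_isEPDF {F : Type*} [Field F] [CharP F 2] [Fintype F] {r q N : ℕ}
    (hr : 1 ≤ r) (hq : q = 2 ^ r) (hF : Fintype.card F = q ^ 4) (hN : N = (q ^ 2 + 1) * (q + 1)) :
    ∃ A : Fin (q + 1) → Finset (ZMod N), IsDPDF N (q + 1) (q ^ 2) (q ^ 2 - 1) 0 A ∧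
      IsEPDF N (q + 1) (q ^ 2) (N - 2 * (q + 1) - (q ^ 2 - 1)) (N - (q + 1)) A := by
  classical
  have hq2 : 2 ≤ q := hq ▸ (by simpa using Nat.pow_le_pow_right (n := 2) (by norm_num) hr)
  have h4 : 4 ≤ q ^ 2 := by nlinarith
  have : NeZero N := ⟨by rw [hN]; positivity⟩
  have hFN : Fintype.card F = (q - 1) * N + 1 := by
    rw [hF, hN]
    zify [show 1 ≤ q by omega]
    ring
  obtain ⟨π, hπ, hker⟩ := exists_surjective_unitsHom hFN (by omega)
  have hL : Nat.card π.ker = q - 1 := by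
    rw [← card_units_pow_eq_one hFN, ← Fintype.card_subtype, ← Nat.card_eq_fintype_card]
    exact Nat.card_congr (Equiv.subtypeEquivRight fun u => hker u)
  have hcount (P : ZMod N → Prop) : #{z : Fˣ | P (π z).toAdd} = (q - 1) * #{y | P y} := by
    rw [card_filter_comp_of_surjective π hπ P, hL]
  have hfix {l : Fˣ} (hl : l ^ (q - 1) = 1) : (l : F) ^ q ^ 2 = l :=
    pow_sq_eq_self_of_pow_eq_one (by omega) (by simpa [Units.ext_iff] using hl)
  obtain ⟨c, hc⟩ : ∃ c : ZMod N → F, ∀ z : Fˣ, c (π z).toAdd = relTrace q (z : F) ^ (q - 1) := by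
    obtain ⟨σ, hσ⟩ := hπ.hasRightInverse
    refine ⟨fun y => relTrace q (σ (Multiplicative.ofAdd y) : F) ^ (q - 1), fun z => ?_⟩
    obtain ⟨x, hx⟩ : ∃ x, x = σ (π z) := ⟨_, rfl⟩
    have hxz : π x = π z := hx ▸ hσ (π z)
    have hl : (x * z⁻¹) ^ (q - 1) = 1 := by
      rw [← hker, map_mul, map_inv, hxz, mul_inv_cancel]
    have hx' : x = (x * z⁻¹) * z := by simp
    change relTrace q (σ (π z) : F) ^ (q - 1) = _
    rw [← hx, hx', Units.val_mul, relTrace_mul (hfix hl), mul_pow, ← Units.val_pow_eq_pow_val, hl,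
      Units.val_one, one_mul]
  have hsurj (y : ZMod N) : ∃ z : Fˣ, (π z).toAdd = y := hπ (Multiplicative.ofAdd y)
  have hc0 (z : Fˣ) : c (π z).toAdd = 0 ↔ relTrace q (z : F) = 0 := by
    rw [hc, pow_eq_zero_iff (by omega)]
  have hadd (y z : Fˣ) : (π y).toAdd + (π z).toAdd = (π (y * z)).toAdd := by
    rw [map_mul, toAdd_mul]
  have htrans (y g : ZMod N) (hg : c g = 0) : ∃ u : F, c (y + g) = u ^ (q - 1) * c y ∧
      ∃ z : Fˣ, (π z).toAdd = g ∧ u = z := by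
    obtain ⟨y, rfl⟩ := hsurj y
    obtain ⟨k, rfl⟩ := hsurj g
    rw [hc0, relTrace_eq_zero_iff] at hg
    refine ⟨k, ?_, k, rfl, rfl⟩
    rw [hadd, hc, hc, mul_comm y, Units.val_mul, relTrace_mul hg, mul_pow]
  let H : AddSubgroup (ZMod N) :=
    { carrier := {y | c y = 0}
      zero_mem' := by
        have := (hc0 1).2 ((relTrace_eq_zero_iff _).2 (by simp))
        rwa [map_one, toAdd_one] at this
      add_mem' := by
        intro y g (hy : c y = 0) (hg : c g = 0)
        obtain ⟨u, h, -⟩ := htrans y g hg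
        change c (y + g) = 0
        rw [h, hy, mul_zero]
      neg_mem' := by
        intro y (hy : c y = 0)
        obtain ⟨y, rfl⟩ := hsurj y
        change c (-(π y).toAdd) = 0
        rw [← toAdd_inv, ← map_inv, hc0, relTrace_eq_zero_iff, Units.val_inv_eq_inv_val, inv_pow,
          (relTrace_eq_zero_iff _).1 ((hc0 y).1 hy)] }
  have hmemH (y : ZMod N) : y ∈ H ↔ c y = 0 := Iff.rfl
  have hcardH : #{y | c y = 0} = q + 1 := by
    have h := hcount fun y => c y = 0
    simp only [hc0] at h
    rw [card_relTrace_eq_zero hq2 hF, show q ^ 2 - 1 = (q - 1) * (q + 1) by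
      rw [mul_comm, ← Nat.sq_sub_sq, one_pow]] at h
    exact (Nat.eq_of_mul_eq_mul_left (by omega) h).symm
  -- `κ` generates `𝔽_{q^2}^*`; translation by the image of `κ ^ i` carries `A 0` onto `A i`, so all
  -- classes have equal size.
  obtain ⟨κ, η, hκ, hκη, hη⟩ : ∃ κ η : Fˣ, (κ : F) ^ q ^ 2 = κ ∧ κ ^ (q - 1) = η ∧
      IsPrimitiveRoot (η : F) (q + 1) := by
    obtain ⟨g, hg⟩ := IsCyclic.exists_ofOrder_eq_natCard (α := Fˣ)
    have hfac : Nat.card Fˣ = ((q ^ 2 + 1) * (q - 1)) * (q + 1) := by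
      rw [Nat.card_units, Nat.card_eq_fintype_card (α := F), hFN, Nat.add_sub_cancel, hN]
      ring
    have hprim := IsPrimitiveRoot.orderOf g
    rw [hg] at hprim
    refine ⟨g ^ (q ^ 2 + 1), _, ?_, rfl, ?_⟩
    · rw [pow_eq_self_iff (by omega) (Units.ne_zero _), ← Units.val_pow_eq_pow_val, ← pow_mul,
        show (q ^ 2 + 1) * (q ^ 2 - 1) = Nat.card Fˣ by
          rw [hfac, mul_assoc, show q ^ 2 - 1 = (q - 1) * (q + 1) by
            rw [mul_comm, ← Nat.sq_sub_sq, one_pow]], hprim.pow_eq_one, Units.val_one]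
    · rw [IsPrimitiveRoot.coe_units_iff, ← pow_mul]
      exact hprim.pow Nat.card_pos hfac
  let A : Fin (q + 1) → Finset (ZMod N) := fun i => {y | c y = (η : F) ^ (i : ℕ)}
  have hmemA (i y) : y ∈ A i ↔ c y = (η : F) ^ (i : ℕ) := by simp [A]
  have hA (i j : Fin (q + 1)) (hij : i ≠ j) : Disjoint (A i) (A j) := by
    rw [disjoint_left]
    intro y hy hy'
    rw [hmemA] at hy hy'
    exact hij (Fin.ext (hη.pow_inj i.2 j.2 (hy.symm.trans hy')))
  have hS (y : ZMod N) : y ∈ univ.biUnion A ↔ y ∉ H := by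
    simp only [mem_biUnion, mem_univ, true_and, hmemA, hmemH]
    constructor
    · rintro ⟨i, hi⟩
      rw [hi]
      exact pow_ne_zero _ η.ne_zero
    · intro hy
      have h1 : c y ^ (q + 1) = 1 := by
        obtain ⟨z, rfl⟩ := hsurj y
        rw [hc0] at hy
        rw [hc, ← pow_mul, show (q - 1) * (q + 1) = q ^ 2 - 1 by
            rw [mul_comm, ← Nat.sq_sub_sq, one_pow], ← pow_eq_self_iff (by omega) hy]
        exact relTrace_pow hq hF _
      obtain ⟨i, hi, h⟩ := hη.eq_pow_of_pow_eq_one h1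
      exact ⟨⟨i, hi⟩, h.symm⟩
  have hcardA' (i : Fin (q + 1)) : #(A i) = #(A 0) := by
    have hκ0 : c (π (κ ^ (i : ℕ))).toAdd = 0 := by
      rw [hc0, relTrace_eq_zero_iff, Units.val_pow_eq_pow_val, ← pow_mul, mul_comm, pow_mul, hκ]
    have hshift (y : ZMod N) : c (y + (π (κ ^ (i : ℕ))).toAdd) = (η : F) ^ (i : ℕ) * c y := by
      obtain ⟨y, rfl⟩ := hsurj y
      rw [hadd, hc, hc, mul_comm, Units.val_mul,
        relTrace_mul ((relTrace_eq_zero_iff _).1 ((hc0 _).1 hκ0)), mul_pow, ← hκη]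
      congr 1
      rw [Units.val_pow_eq_pow_val, Units.val_pow_eq_pow_val, ← pow_mul, ← pow_mul, mul_comm]
    symm
    refine card_bij' (fun y _ => y + (π (κ ^ (i : ℕ))).toAdd)
      (fun y _ => y - (π (κ ^ (i : ℕ))).toAdd) ?_ ?_ (by simp) (by simp)
    · intro y hy
      rw [hmemA] at hy ⊢
      rw [hshift, hy]
      simp
    · intro y hy
      rw [hmemA] at hy ⊢
      have h := hshift (y - (π (κ ^ (i : ℕ))).toAdd)
      rw [sub_add_cancel, hy] at h
      simpa using (mul_eq_left₀ (pow_ne_zero _ η.ne_zero)).1 h.symm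
  have hcardA (i : Fin (q + 1)) : #(A i) = q ^ 2 := by
    have h : #(univ.biUnion A) = (q + 1) * #(A 0) := by
      rw [card_biUnion fun i _ j _ hij => hA i j hij, sum_congr rfl fun i _ => hcardA' i, sum_const,
        card_univ, Fintype.card_fin, smul_eq_mul]
    have h2 : univ.biUnion A = ({y | c y = 0} : Finset (ZMod N))ᶜ := by
      ext y
      rw [hS, hmemH]
      simp
    have hNq : N - (q + 1) = (q + 1) * q ^ 2 := by
      rw [hN, add_mul, one_mul, Nat.add_sub_cancel, mul_comm]
    rw [h2, card_compl, hcardH, ZMod.card, hNq] at h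
    rw [hcardA', ← Nat.eq_of_mul_eq_mul_left (Nat.succ_pos q) h]
  have hcoset (i) (x : ZMod N) (hx : x ∈ A i) (g : ZMod N) (hg : g ∈ H) (hxg : x + g ∈ A i) :
      g = 0 := by
    obtain ⟨u, h, z, rfl, rfl⟩ := htrans x g hg
    rw [hmemA] at hx hxg
    rw [hxg, hx] at h
    -- Moving by `z ∈ 𝔽_{q^2}^*` scales `c` by `z ^ (q - 1)`, which is 1 only for `z ∈ 𝔽_q^*`.
    have h1 := (mul_eq_right₀ (pow_ne_zero _ η.ne_zero)).1 h.symm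
    have h2 : π z = 1 := (hker z).2 (Units.ext (by simpa using h1))
    rw [h2, toAdd_one]
  have hlam (g : ZMod N) (hg : g ∉ H) :
      #(univ.biUnion fun i => {y ∈ A i | y + g ∈ A i}) = q ^ 2 - 1 := by
    have h1 : (univ.biUnion fun i => {y ∈ A i | y + g ∈ A i}) =
        ({y | c y ≠ 0 ∧ c (g + y) = c y} : Finset (ZMod N)) := by
      ext y
      simp only [mem_biUnion, mem_filter, mem_univ, true_and, hmemA, add_comm g]
      constructor
      · rintro ⟨i, h1, h2⟩
        exact ⟨h1 ▸ pow_ne_zero _ η.ne_zero, h2.trans h1.symm⟩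
      · rintro ⟨h1, h2⟩
        obtain ⟨i, -, hi⟩ := mem_biUnion.1 ((hS y).2 h1)
        exact ⟨i, (hmemA i y).1 hi, h2.trans ((hmemA i y).1 hi)⟩
    rw [h1]
    obtain ⟨w, rfl⟩ := hsurj g
    -- Lifting to `Fˣ` multiplies the count by `q - 1`, the factor cancelled at the end.
    have h := hcount fun y => c y ≠ 0 ∧ c ((π w).toAdd + y) = c y
    simp only [ne_eq, hc0, hadd] at h
    simp only [hc] at h
    rw [hmemH, hc0] at hg
    have h3 := card_relTrace_mul_pow_eq hr hq hF w hg
    exact (Nat.eq_of_mul_eq_mul_left (by omega) (h3.symm.trans h)).symm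
  have hcardH' : Nat.card H = q + 1 := by
    rw [← hcardH, ← Fintype.card_subtype, ← Nat.card_eq_fintype_card]
    exact Nat.card_congr (Equiv.refl _)
  have h := isDPDF_and_isEPDF_of_partition_compl H A hcardA hA hS hcardH' hcoset hlam
  rw [Nat.card_zmod] at h
  exact ⟨A, h⟩

end PartialDiffFamily

/-! ### Matching the parameters -/

theorem corollary4p15 (r n m : ℕ) (hr : 1 ≤ r) (hn : n = 2 ^ r + 1) (hm : m = (n - 1) ^ 2 + 1) :
    ∃ A : Fin n → Finset (ZMod (m * n)),
      PartialDiffFamily.IsDPDF (m * n) n ((n - 1) ^ 2) (n * (n - 2)) 0 A ∧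
      PartialDiffFamily.IsEPDF (m * n) n ((n - 1) ^ 2)
        (n * (n - 1) * (n - 2)) (n * (n - 1) ^ 2) A := by
  obtain ⟨q, hq⟩ : ∃ q, q = 2 ^ r := ⟨_, rfl⟩
  rw [← hq] at hn
  subst hn
  rw [Nat.add_sub_cancel] at hm ⊢
  subst hm
  have : Fact (Nat.Prime 2) := ⟨Nat.prime_two⟩
  let _ : Fintype (GaloisField 2 (r * 4)) := Fintype.ofFinite _
  have hF : Fintype.card (GaloisField 2 (r * 4)) = q ^ 4 := by
    rw [← Nat.card_eq_fintype_card, GaloisField.card 2 (r * 4) (by omega), hq, pow_mul]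
  obtain ⟨A, h1, h2⟩ := PartialDiffFamily.exists_isDPDF_and_isEPDF hr hq hF rfl
  refine ⟨A, ?_⟩
  -- With `q = p + 1` the truncated subtractions become polynomial identities in `p`.
  obtain ⟨p, rfl⟩ : ∃ p, q = p + 1 := ⟨q - 1, by have := Nat.one_le_two_pow (n := r); omega⟩
  have e1 : (p + 1) ^ 2 - 1 = (p + 1 + 1) * (p + 1 + 1 - 2) := by
    rw [show p + 1 + 1 - 2 = p by omega]
    exact Nat.sub_eq_of_eq_add (by ring)
  have e2 : ((p + 1) ^ 2 + 1) * (p + 1 + 1) - (p + 1 + 1) = (p + 1 + 1) * (p + 1) ^ 2 := by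
    rw [add_mul, one_mul, Nat.add_sub_cancel, mul_comm]
  have e3 : ((p + 1) ^ 2 + 1) * (p + 1 + 1) - 2 * (p + 1 + 1) - ((p + 1) ^ 2 - 1) =
      (p + 1 + 1) * (p + 1) * (p + 1 + 1 - 2) := by
    rw [e1, show p + 1 + 1 - 2 = p by omega, Nat.sub_sub]
    exact Nat.sub_eq_of_eq_add (by ring)
  rw [e1] at h1
  rw [e3, e2] at h2
  exact ⟨h1, h2⟩
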